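/- Let $R$ be a finite group and let $R^\ast$ be the rooted tree of finite words over $R$, the children of a word $u$ being the words $ux$ with $x\in R$. Let $\operatorname{Aut}(R^\ast)$ be its automorphism group; for an automorphism $g$ and a word $v$, the section $g|_v$ is the automorphism with $g(vu)=g(v)\,g|_v(u)$ for all $u$. The group $R$ is identified with the group of rooted automorphisms that act on the first letter by left multiplication. An automorphism $g$ is called directed if it fixes the first layer, $g|_{e}=g$, and every $g|_x$ with $x\in R\smallsetminus\{e\}$ is rooted. If $D\le\operatorname{Aut}(R^\ast)$ is a group of directed automorphisms all of whose labels are left multiplications by elements of $R$ and such that the sections $d|_x$ ($d\in D$, $x\in R\smallsetminus\{e\}$) generate $R$, then $\langle R\cup D\rangle$ is called a constant spinal group with rooted group $R$ and directed group $D$. A subgroup $G\le\operatorname{Aut}(R^\ast)$ is branch if it acts transitively on every layer $R^n$ and, for every $n$, the product of the rigid stabilisers of the vertices of the $n$-th layer has finite index in $G$. It is layered if it is transitive on every layer, contains all sections of its elements, and contains, with finite index, the group $G^R$ of all automorphisms that fix the first layer and have all first layer sections in $G$. It has the congruence subgroup property if each of its normal subgroups of finite index contains the pointwise stabiliser in $G$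 of some layer. $\mathcal{MF}$ is the class of groups all of whose maximal subgroups have finite index. A subgroup $H\le G$ is prodense if $HN=G$ for every non-trivial normal subgroup $N$ of $G$. **Theorem.** There exists a branch group outside $\mathcal{MF}$ without the congruence subgroup property. More precisely, for $R=\operatorname{Alt}(5)$ there are groups $T\le D$ of directed automorphisms of $R^\ast$, with $D\cong\operatorname{Alt}(4)$ and $T$ cyclic of order $3$, such that $G=\langle R\cup D\rangle$ and $H=\langle R\cup T\rangle$ are both constant spinal groups with rooted group $R$ (with directed groups $D$ and $T$, respectively), and such that $G$ is layered, is a branch group, does not belong to $\mathcal{MF}$ and does not have the congruence subgroup property, while $H$ is a prodense subgroup of $G$ and a maximal subgroup of $G$ of infinite index. -/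

import Mathlib

open scoped Pointwise

namespace RootedTree

/-- Automorphisms of the rooted tree of finite words over `X`: the vertices are the words, the root
is the empty word, the children of `u` are the words `u ++ [x]`.  An automorphism is a bijection
on the vertices that fixes the root and maps children of `u` to children of the image of `u`.
Multiplication is composition, `(f * g) u = f (g u)`. -/
def treeAut (X : Type*) : Subgroup (Equiv.Perm (List X)) where
  carrier := {g | g [] = [] ∧ ∀ (u : List X) (x : X), ∃ y : X, g (u ++ [x]) = g u ++ [y]}
  one_mem' := ⟨rfl, fun _ x => ⟨x, rfl⟩⟩
  mul_mem' := by
    rintro f g ⟨hf, hf'⟩ ⟨hg, hg'⟩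
    refine ⟨by simp [hf, hg], fun u x => ?_⟩
    obtain ⟨y, hy⟩ := hg' u x
    obtain ⟨z, hz⟩ := hf' (g u) y
    exact ⟨z, by simp [hy, hz]⟩
  inv_mem' := by
    rintro g ⟨hg, hg'⟩
    refine ⟨by rw [Equiv.Perm.inv_eq_iff_eq, hg], fun v y => ?_⟩
    rcases List.eq_nil_or_concat (g⁻¹ (v ++ [y])) with h | ⟨w, x, h⟩
    · rw [Equiv.Perm.inv_eq_iff_eq, hg] at h
      simp at h
    · obtain ⟨z, hz⟩ := hg' w x
      have h1 : v ++ [y] = g w ++ [z] := by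
        rw [← hz]
        rw [Equiv.Perm.inv_eq_iff_eq] at h
        simpa using h
      obtain ⟨h2, -⟩ := List.append_inj' h1 rfl
      refine ⟨x, ?_⟩
      rw [h, h2]
      simp

abbrev TreeAut (X : Type*) : Type _ := ↥(treeAut X)

section Basic

variable {X : Type*}

theorem TreeAut.exists_append (g : TreeAut X) (v u : List X) :
    ∃ w : List X, w.length = u.length ∧ g.1 (v ++ u) = g.1 v ++ w := by
  induction u using List.reverseRecOn with
  | nil => exact ⟨[], rfl, by simp⟩
  | append_singleton u x ih =>
    obtain ⟨w, hw, h⟩ := ih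
    obtain ⟨y, hy⟩ := g.2.2 (v ++ u) x
    refine ⟨w ++ [y], by simp [hw], ?_⟩
    rw [← List.append_assoc, hy, h, List.append_assoc]

theorem TreeAut.length_apply (g : TreeAut X) (u : List X) : (g.1 u).length = u.length := by
  obtain ⟨w, hw, h⟩ := g.exists_append [] u
  rw [g.2.1] at h
  simp only [List.nil_append] at h
  rw [h, hw]

/-- Auxiliary map: `g (v ++ u) = g v ++ sectFun g v u`. -/
def sectFun (g : TreeAut X) (v u : List X) : List X := (g.1 (v ++ u)).drop v.length

theorem append_sectFun (g : TreeAut X) (v u : List X) :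
    g.1 (v ++ u) = g.1 v ++ sectFun g v u := by
  obtain ⟨w, -, h⟩ := g.exists_append v u
  rw [sectFun, h, ← g.length_apply v, List.drop_left]

theorem sectFun_inv_left (g : TreeAut X) (v u : List X) :
    sectFun g⁻¹ (g.1 v) (sectFun g v u) = u := by
  have h := append_sectFun g⁻¹ (g.1 v) (sectFun g v u)
  rw [← append_sectFun] at h
  simpa using h.symm

/-- The section of `g` at `v`: the unique automorphism `h` with `g (v ++ u) = g v ++ h u`
for every word `u`. -/
def sect (g : TreeAut X) (v : List X) : TreeAut X :=
  ⟨{ toFun := sectFun g v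
     invFun := sectFun g⁻¹ (g.1 v)
     left_inv := sectFun_inv_left g v
     right_inv := fun u => by
      have h := sectFun_inv_left g⁻¹ (g.1 v) u
      simpa using h },
   by
    constructor
    · have h := append_sectFun g v []
      simpa using h
    · intro u x
      obtain ⟨y, hy⟩ := g.2.2 (v ++ u) x
      refine ⟨y, ?_⟩
      rw [List.append_assoc, append_sectFun, append_sectFun, List.append_assoc] at hy
      exact List.append_cancel_left hy⟩

theorem append_sect (g : TreeAut X) (v u : List X) :
    g.1 (v ++ u) = g.1 v ++ (sect g v).1 u := append_sectFun g v u

/-- Auxiliary map: `g (v ++ [x]) = g v ++ [labelFun g v x]`. -/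
noncomputable def labelFun (g : TreeAut X) (v : List X) (x : X) : X := (g.2.2 v x).choose

theorem append_labelFun (g : TreeAut X) (v : List X) (x : X) :
    g.1 (v ++ [x]) = g.1 v ++ [labelFun g v x] := (g.2.2 v x).choose_spec

theorem labelFun_inv_left (g : TreeAut X) (v : List X) (x : X) :
    labelFun g⁻¹ (g.1 v) (labelFun g v x) = x := by
  have h := append_labelFun g⁻¹ (g.1 v) (labelFun g v x)
  rw [← append_labelFun] at h
  simpa using h.symm

/-- The label of `g` at `v`: the unique permutation `σ` of `X` with
`g (v ++ [x]) = g v ++ [σ x]` for every letter `x`. -/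
noncomputable def label (g : TreeAut X) (v : List X) : Equiv.Perm X where
  toFun := labelFun g v
  invFun := labelFun g⁻¹ (g.1 v)
  left_inv := labelFun_inv_left g v
  right_inv := fun x => by
    have h := labelFun_inv_left g⁻¹ (g.1 v) x
    simpa using h

theorem append_label (g : TreeAut X) (v : List X) (x : X) :
    g.1 (v ++ [x]) = g.1 v ++ [label g v x] := append_labelFun g v x

theorem label_one (v : List X) : label (1 : TreeAut X) v = 1 := by
  ext x
  have h := append_label (1 : TreeAut X) v x
  simpa using h.symm

theorem label_mul (f g : TreeAut X) (v : List X) :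
    label (f * g) v = label f (g.1 v) * label g v := by
  ext x
  have h := append_label (f * g) v x
  simp only [Subgroup.coe_mul, Equiv.Perm.mul_apply] at h
  rw [append_label, append_label] at h
  simpa using h.symm

theorem label_inv (g : TreeAut X) (v : List X) :
    label g⁻¹ v = (label g ((g⁻¹).1 v))⁻¹ := by
  have h := label_mul g g⁻¹ v
  rw [mul_inv_cancel, label_one] at h
  exact (inv_eq_of_mul_eq_one_right h.symm).symm

/-- The group of all automorphisms whose labels lie in the permutation group `P`. -/
def gammaGroup (P : Subgroup (Equiv.Perm X)) : Subgroup (TreeAut X) where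
  carrier := {g | ∀ v : List X, label g v ∈ P}
  one_mem' := fun v => by rw [label_one]; exact P.one_mem
  mul_mem' := fun {f g} hf hg v => by rw [label_mul]; exact P.mul_mem (hf _) (hg _)
  inv_mem' := fun {g} hg v => by rw [label_inv]; exact P.inv_mem (hg _)

/-- The rooted automorphism of a permutation of `X`: it permutes the first letters of words. -/
def rootedFun (σ : Equiv.Perm X) : List X → List X
  | [] => []
  | x :: w => σ x :: w

/-- The embedding of `Sym(X)` as the group of rooted automorphisms. -/
def rooted : Equiv.Perm X →* TreeAut X where
  toFun σ :=
    ⟨{ toFun := rootedFun σ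
       invFun := rootedFun σ⁻¹
       left_inv := fun w => by cases w <;> simp [rootedFun]
       right_inv := fun w => by cases w <;> simp [rootedFun] },
     rfl, fun u x => by cases u <;> simp [rootedFun]⟩
  map_one' := by
    ext1; ext1 w
    cases w <;> simp [rootedFun]
  map_mul' σ τ := by
    ext1; ext1 w
    cases w <;> simp [rootedFun]

/-- The automorphism fixing the first layer and acting as `h x` below the letter `x`. -/
def baseFun (h : X → TreeAut X) : List X → List X
  | [] => []
  | x :: w => x :: (h x).1 w

/-- The embedding of the base group `Aut(X*)^X` of the wreath decomposition into `Aut(X*)`;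
the element `h` is sent to the automorphism fixing the first layer with section `h x` at `x`. -/
def baseHom : (X → TreeAut X) →* TreeAut X where
  toFun h :=
    ⟨{ toFun := baseFun h
       invFun := baseFun h⁻¹
       left_inv := fun w => by cases w <;> simp [baseFun]
       right_inv := fun w => by cases w <;> simp [baseFun] },
     rfl, fun u x => by
      cases u with
      | nil => simp [baseFun, (h x).2.1]
      | cons a u =>
        obtain ⟨y, hy⟩ := (h a).2.2 u x
        exact ⟨y, by simp [baseFun, hy]⟩⟩
  map_one' := by
    ext1; ext1 w
    cases w <;> simp [baseFun]
  map_mul' f g := by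
    ext1; ext1 w
    cases w <;> simp [baseFun]

/-- The pointwise stabiliser of the `n`-th layer. -/
def layerStab (X : Type*) (n : ℕ) : Subgroup (TreeAut X) where
  carrier := {g | ∀ v : List X, v.length = n → g.1 v = v}
  one_mem' := fun _ _ => rfl
  mul_mem' := fun {f g} hf hg v hv => by
    simp only [Subgroup.coe_mul, Equiv.Perm.mul_apply]
    rw [hg v hv, hf v hv]
  inv_mem' := fun {g} hg v hv => by
    simp only [Subgroup.coe_inv]
    rw [Equiv.Perm.inv_eq_iff_eq, hg v hv]

/-- The rigid stabiliser in `G` of the vertex `v`: the elements of `G` that move only vertices of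
the subtree below `v`. -/
def rist (G : Subgroup (TreeAut X)) (v : List X) : Subgroup (TreeAut X) where
  carrier := {g | g ∈ G ∧ ∀ u : List X, ¬ v <+: u → g.1 u = u}
  one_mem' := ⟨G.one_mem, fun _ _ => rfl⟩
  mul_mem' := fun {f g} hf hg => ⟨G.mul_mem hf.1 hg.1, fun u hu => by
    simp only [Subgroup.coe_mul, Equiv.Perm.mul_apply]
    rw [hg.2 u hu, hf.2 u hu]⟩
  inv_mem' := fun {g} hg => ⟨G.inv_mem hg.1, fun u hu => by
    simp only [Subgroup.coe_inv]
    rw [Equiv.Perm.inv_eq_iff_eq, hg.2 u hu]⟩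

/-- The rigid stabiliser of the `n`-th layer: the subgroup generated by (which is the product of)
the rigid stabilisers of the vertices of length `n`. -/
def ristLayer (G : Subgroup (TreeAut X)) (n : ℕ) : Subgroup (TreeAut X) :=
  ⨆ (v : List X) (_ : v.length = n), rist G v

def IsSphericallyTransitive (G : Subgroup (TreeAut X)) : Prop :=
  ∀ u v : List X, u.length = v.length → ∃ g ∈ G, g.1 u = v

def IsSelfSimilar (G : Subgroup (TreeAut X)) : Prop :=
  ∀ g ∈ G, ∀ v : List X, sect g v ∈ G

/-- A branch group: spherically transitive, and all rigid layer stabilisers have finite index. -/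
def IsBranch (G : Subgroup (TreeAut X)) : Prop :=
  IsSphericallyTransitive G ∧ ∀ n : ℕ, ((ristLayer G n).subgroupOf G).FiniteIndex

/-- The image of `K^X` in `Aut(X*)` under the embedding of the base group. -/
def basePower (K : Subgroup (TreeAut X)) : Subgroup (TreeAut X) :=
  (Subgroup.pi Set.univ fun _ : X => K).map baseHom

/-- `G` is regular branch over `K`: `G` is spherically transitive, `K` has finite index in `G`,
and `K^X` is contained in `K`, with finite index. -/
def IsRegularBranchOver (G K : Subgroup (TreeAut X)) : Prop :=
  IsSphericallyTransitive G ∧ K ≤ G ∧ (K.subgroupOf G).FiniteIndex ∧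
    basePower K ≤ K ∧ ((basePower K).subgroupOf K).FiniteIndex

/-- A layered group: self-similar and regular branch over itself. -/
def IsLayered (G : Subgroup (TreeAut X)) : Prop :=
  IsSelfSimilar G ∧ IsRegularBranchOver G G

/-- The congruence subgroup property: every normal subgroup of finite index contains the
stabiliser of some layer. -/
def HasCSP (G : Subgroup (TreeAut X)) : Prop :=
  ∀ N : Subgroup G, N.Normal → N.FiniteIndex → ∃ n : ℕ, (layerStab X n).subgroupOf G ≤ N

end Basic

section Spinal

variable (R : Type*) [Group R]

/-- The left multiplications in `Sym(R)`. -/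
def cayley : Subgroup (Equiv.Perm R) := (MulAction.toPermHom R R).range

/-- The group `R`, acting on the first letter of the words over `R` by left multiplication. -/
def rootedGroup : Subgroup (TreeAut R) := (cayley R).map rooted

variable {R}

/-- A directed automorphism `g` of the tree of words over `R`: it fixes the first layer, its
section at the letter `1` is `g` itself, and its sections at the other letters are rooted. -/
def IsDirected (g : TreeAut R) : Prop :=
  g ∈ layerStab R 1 ∧ sect g [1] = g ∧ ∀ x : R, x ≠ 1 → sect g [x] ∈ (rooted (X := R)).range

/-- `D` can serve as the directed group of a constant spinal group with rooted group `R`. -/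
structure IsDirectedGroup (D : Subgroup (TreeAut R)) : Prop where
  le_gamma : D ≤ gammaGroup (cayley R)
  directed : ∀ d ∈ D, IsDirected d
  generation :
    Subgroup.closure {s : TreeAut R | ∃ d ∈ D, ∃ x : R, x ≠ 1 ∧ s = sect d [x]} = rootedGroup R

/-- The group generated by the rooted group `R` and by `D`. -/
def spinalGroup (D : Subgroup (TreeAut R)) : Subgroup (TreeAut R) := rootedGroup R ⊔ D

end Spinal

section Abstract

variable (G : Type*) [Group G]

/-- The class of groups all of whose maximal subgroups have finite index. -/
def IsMF : Prop := ∀ M : Subgroup G, IsCoatom M → M.FiniteIndex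

variable {G}

/-- `H N = G` for every non-trivial normal subgroup `N`. -/
def IsProdense (H : Subgroup G) : Prop :=
  ∀ N : Subgroup G, N.Normal → N ≠ ⊥ → (H : Set G) * (N : Set G) = Set.univ

end Abstract

end RootedTree

open RootedTree

/-! Let `Alt(4)` act by directed automorphisms whose rooted sections are non-trivial at most at the
two letters `s = (0 1 2)` and `t = (2 3 4)`; let `D` be its image and `T` the image of a subgroup of
order 3. Write `G = ⟨R ∪ D⟩` and `H = ⟨R ∪ T⟩`.

Both groups contain their own power over the first layer (`vertClosed_spinalGroup`). The commutator
of a directed element with a suitable rooted conjugate lives below a single letter, and simplicity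
of `R` spreads it to all of `R`. Being layered and branch follows formally.

Iterated sections of every element end in the nucleus `R ∪ D` (`exists_sectLevel`), which has three
consequences. Since a directed element recurs as its own section, `D ∩ H = T`, so `H ≠ G`. For
maximality (`spinalGroup_le_of_normalizes`), an element of `G` outside `H` has a section outside
`H`; descending reaches an element of `D` outside `T`, and `T` with its conjugate by that element
generates `D`. Finally, a character of `D` extends to `G` by multiplying its values on deep
sections. Placing an element below a letter preserves this value, so the kernel contains no layer
stabiliser (`not_hasCSP`).

The core of `H` in `G` is trivial (`eq_bot_of_normal`): commutators of a non-trivial normal subgroup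
with elements supported below a moved vertex have arbitrary elements of `G` as sections. Hence the
maximal subgroup `H` is prodense and of infinite index. -/

namespace RootedTree

open scoped commutatorElement

/-! ### Calculus of sections, labels and the wreath decomposition. -/

section Sections

variable {X : Type*}

theorem treeAut_ext {f g : TreeAut X} (h : ∀ u, f.1 u = g.1 u) : f = g :=
  Subtype.ext (Equiv.ext h)

theorem sect_eq_of_append {g h : TreeAut X} {v : List X}
    (H : ∀ u, g.1 (v ++ u) = g.1 v ++ h.1 u) : sect g v = h :=
  treeAut_ext fun u => List.append_cancel_left ((append_sect g v u).symm.trans (H u))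

theorem sect_one (v : List X) : sect (1 : TreeAut X) v = 1 :=
  sect_eq_of_append fun _ => rfl

theorem sect_nil (g : TreeAut X) : sect g [] = g :=
  sect_eq_of_append fun u => by simp [g.2.1]

theorem sect_mul (f g : TreeAut X) (v : List X) :
    sect (f * g) v = sect f (g.1 v) * sect g v :=
  sect_eq_of_append fun u => by
    simp only [Subgroup.coe_mul, Equiv.Perm.mul_apply, append_sect]

theorem sect_inv (g : TreeAut X) (v : List X) : sect g⁻¹ v = (sect g (g⁻¹.1 v))⁻¹ := by
  have h := sect_mul g g⁻¹ v
  rw [mul_inv_cancel, sect_one] at h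
  exact (inv_eq_of_mul_eq_one_right h.symm).symm

theorem sect_append (g : TreeAut X) (u v : List X) : sect g (u ++ v) = sect (sect g u) v :=
  sect_eq_of_append fun w => by simp only [List.append_assoc, append_sect]

theorem sect_cons (g : TreeAut X) (x : X) (v : List X) : sect g (x :: v) = sect (sect g [x]) v :=
  sect_append g [x] v

theorem apply_singleton (g : TreeAut X) (x : X) : g.1 [x] = [label g [] x] := by
  have h := append_label g [] x
  rwa [g.2.1] at h

theorem apply_cons (g : TreeAut X) (x : X) (w : List X) :
    g.1 (x :: w) = label g [] x :: (sect g [x]).1 w := by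
  have h := append_sect g [x] w
  rwa [apply_singleton] at h

theorem label_append (g : TreeAut X) (u v : List X) :
    label g (u ++ v) = label (sect g u) v := by
  ext x
  have h := append_label g (u ++ v) x
  rw [List.append_assoc, append_sect, append_sect g u v, append_label (sect g u), List.append_assoc] at h
  simpa using (List.append_cancel_left (List.append_cancel_left h)).symm

theorem label_cons (g : TreeAut X) (x : X) (v : List X) :
    label g (x :: v) = label (sect g [x]) v :=
  label_append g [x] v

theorem rooted_apply_cons (σ : Equiv.Perm X) (x : X) (w : List X) :
    (rooted σ).1 (x :: w) = σ x :: w := rfl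

theorem sect_rooted_singleton (σ : Equiv.Perm X) (x : X) : sect (rooted σ) [x] = 1 :=
  sect_eq_of_append fun _ => rfl

theorem label_rooted_nil (σ : Equiv.Perm X) : label (rooted σ) [] = σ := by
  ext x
  have h := (apply_singleton (rooted σ) x).symm
  simpa [rooted_apply_cons] using h

theorem baseHom_apply_cons (h : X → TreeAut X) (x : X) (w : List X) :
    (baseHom h).1 (x :: w) = x :: (h x).1 w := rfl

theorem baseHom_apply_singleton (h : X → TreeAut X) (x : X) : (baseHom h).1 [x] = [x] := by
  rw [baseHom_apply_cons, (h x).2.1]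

theorem sect_baseHom_singleton (h : X → TreeAut X) (x : X) : sect (baseHom h) [x] = h x :=
  sect_eq_of_append fun u => by
    rw [baseHom_apply_singleton]
    rfl

theorem baseHom_injective : Function.Injective (baseHom (X := X)) := fun f g h => by
  funext x
  rw [← sect_baseHom_singleton f, h, sect_baseHom_singleton]

theorem eq_rooted_mul_baseHom (g : TreeAut X) :
    g = rooted (label g []) * baseHom fun x => sect g [x] := by
  refine treeAut_ext fun u => ?_
  cases u with
  | nil => exact g.2.1
  | cons x w => exact apply_cons g x w

theorem label_nil_of_mem_layerStab_one {g : TreeAut X} (hg : g ∈ layerStab X 1) :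
    label g [] = 1 := by
  ext x
  have h := hg [x] rfl
  rw [apply_singleton] at h
  simpa using h

theorem eq_baseHom_of_label_nil {g : TreeAut X} (hg : label g [] = 1) :
    g = baseHom fun x => sect g [x] := by
  conv_lhs => rw [eq_rooted_mul_baseHom g, hg, map_one, one_mul]

theorem baseHom_mem_layerStab_one (h : X → TreeAut X) : baseHom h ∈ layerStab X 1 := by
  intro v hv
  obtain ⟨x, rfl⟩ := List.length_eq_one_iff.1 hv
  exact baseHom_apply_singleton h x

theorem rooted_conj_baseHom (σ : Equiv.Perm X) (h : X → TreeAut X) :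
    rooted σ * baseHom h * (rooted σ)⁻¹ = baseHom fun x => h (σ⁻¹ x) := by
  rw [← map_inv]
  refine treeAut_ext fun u => ?_
  cases u with
  | nil => rfl
  | cons x w =>
    simp only [Subgroup.coe_mul, Equiv.Perm.mul_apply, rooted_apply_cons, baseHom_apply_cons]
    simp

theorem finiteIndex_layerStab [Finite X] (n : ℕ) : (layerStab X n).FiniteIndex := by
  let φ : TreeAut X →* Equiv.Perm {v : List X // v.length = n} :=
    { toFun := fun g => g.1.subtypePerm fun v => by rw [TreeAut.length_apply]
      map_one' := rfl
      map_mul' := fun _ _ => rfl }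
  have : Finite {v : List X // v.length = n} := List.finite_length_eq X n
  have hk : φ.ker ≤ layerStab X n := fun g hg v hv =>
    congrArg Subtype.val (Equiv.congr_fun (MonoidHom.mem_ker.1 hg) ⟨v, hv⟩)
  exact Subgroup.finiteIndex_of_le hk

end Sections

/-! ### Groups containing their own power: layered and branch. -/

section Vert

variable {X : Type*} [DecidableEq X]

/-- The embedding of `Aut(X*)` as the group of automorphisms that move only vertices
below the letter `x`. -/
def vert (x : X) : TreeAut X →* TreeAut X :=
  baseHom.comp (MonoidHom.mulSingle (fun _ => TreeAut X) x)

theorem vert_apply (x : X) (g : TreeAut X) : vert x g = baseHom (Pi.mulSingle x g) := rfl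

theorem vert_injective (x : X) : Function.Injective (vert x) :=
  baseHom_injective.comp (Pi.mulSingle_injective (M := fun _ => TreeAut X) x)

theorem sect_vert (x : X) (g : TreeAut X) (y : X) :
    sect (vert x g) [y] = Pi.mulSingle (M := fun _ => TreeAut X) x g y :=
  sect_baseHom_singleton _ y

theorem sect_vert_self (x : X) (g : TreeAut X) : sect (vert x g) [x] = g := by
  rw [sect_vert, Pi.mulSingle_eq_same]

theorem rooted_conj_vert (σ : Equiv.Perm X) (x : X) (g : TreeAut X) :
    rooted σ * vert x g * (rooted σ)⁻¹ = vert (σ x) g := by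
  rw [vert_apply, rooted_conj_baseHom, vert_apply]
  congr 1
  funext y
  by_cases h : y = σ x
  · subst h
    simp
  · rw [Pi.mulSingle_eq_of_ne h, Pi.mulSingle_eq_of_ne]
    rintro h'
    exact h (by simp [← h'])

theorem baseHom_conj_vert (h : X → TreeAut X) (x : X) (g : TreeAut X) :
    baseHom h * vert x g * (baseHom h)⁻¹ = vert x (h x * g * (h x)⁻¹) := by
  rw [vert_apply, vert_apply, ← map_inv, ← map_mul, ← map_mul]
  congr 1
  funext y
  by_cases hy : y = x
  · subst hy
    simp
  · simp [Pi.mulSingle_eq_of_ne hy]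

theorem vert_mem_layerStab_succ {x : X} {g : TreeAut X} {n : ℕ} (hg : g ∈ layerStab X n) :
    vert x g ∈ layerStab X (n + 1) := by
  intro v hv
  cases v with
  | nil => simp at hv
  | cons y w =>
    rw [vert_apply, baseHom_apply_cons]
    by_cases hy : y = x
    · subst hy
      rw [Pi.mulSingle_eq_same, hg w (by simpa using hv)]
    · rw [Pi.mulSingle_eq_of_ne hy]
      rfl

/-- `G` contains `G^X`; stated for the generating coordinate subgroups. -/
def VertClosed (G : Subgroup (TreeAut X)) : Prop := ∀ x : X, ∀ g ∈ G, vert x g ∈ G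

/-- A finite direct power is generated by its coordinate subgroups, so membership may be tested one
letter at a time. -/
theorem baseHom_mem_of_vert_mem [Finite X] {K M : Subgroup (TreeAut X)}
    (h : ∀ x, ∀ g ∈ K, vert x g ∈ M) {f : X → TreeAut X} (hf : ∀ x, f x ∈ K) :
    baseHom f ∈ M := by
  have key : Subgroup.pi Set.univ (fun _ : X => K) ≤ M.comap baseHom := by
    rw [Subgroup.pi_le_iff]
    intro x
    rw [Subgroup.map_le_iff_le_comap]
    exact fun g hg => h x g hg
  exact key fun x _ => hf x

theorem VertClosed.basePower_le [Finite X] {G : Subgroup (TreeAut X)} (h : VertClosed G) :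
    basePower G ≤ G := by
  rintro _ ⟨f, hf, rfl⟩
  exact baseHom_mem_of_vert_mem h fun x => hf x trivial

theorem VertClosed.isSphericallyTransitive {G : Subgroup (TreeAut X)} (h : VertClosed G)
    (h1 : ∀ x y : X, ∃ g ∈ G, g.1 [x] = [y]) : IsSphericallyTransitive G := by
  intro u
  induction u with
  | nil =>
    intro v hv
    refine ⟨1, G.one_mem, ?_⟩
    simpa [eq_comm] using hv
  | cons x u ih =>
    rintro (_ | ⟨y, v⟩) hv
    · simp at hv
    obtain ⟨g, hg, hgx⟩ := h1 x y
    -- `k` is chosen so that the section of `g` at `x` carries `k u` to `v`.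
    obtain ⟨k, hk, hku⟩ := ih ((sect g [x])⁻¹.1 v) (by
      rw [TreeAut.length_apply]
      simpa using hv)
    refine ⟨g * vert x k, G.mul_mem hg (h x k hk), ?_⟩
    have h2 : (vert x k).1 (x :: u) = x :: k.1 u := by
      rw [vert_apply, baseHom_apply_cons, Pi.mulSingle_eq_same]
    have h3 := append_sect g [x] (k.1 u)
    simp only [Subgroup.coe_mul, Equiv.Perm.mul_apply, h2]
    rw [List.singleton_append, hgx, hku] at h3
    rw [hku, h3]
    simp

theorem VertClosed.isLayered [Finite X] {G : Subgroup (TreeAut X)} (h : VertClosed G)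
    (hs : IsSelfSimilar G) (h1 : ∀ x y : X, ∃ g ∈ G, g.1 [x] = [y]) : IsLayered G := by
  refine ⟨hs, h.isSphericallyTransitive h1, le_rfl, ?_, h.basePower_le, ?_⟩
  · rw [Subgroup.subgroupOf_self]
    infer_instance
  · have hle : (layerStab X 1).subgroupOf G ≤ (basePower G).subgroupOf G := by
      rintro ⟨g, hg⟩ hg1
      rw [Subgroup.mem_subgroupOf] at hg1 ⊢
      exact ⟨fun x => sect g [x], fun x _ => hs g hg [x],
        (eq_baseHom_of_label_nil (label_nil_of_mem_layerStab_one hg1)).symm⟩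
    have := finiteIndex_layerStab (X := X) 1
    exact Subgroup.finiteIndex_of_le hle

theorem map_vert_rist_le {G : Subgroup (TreeAut X)} (h : VertClosed G) (x : X) (v : List X) :
    (rist G v).map (vert x) ≤ rist G (x :: v) := by
  rintro _ ⟨g, hg, rfl⟩
  refine ⟨h x g hg.1, fun u hu => ?_⟩
  cases u with
  | nil => rfl
  | cons y w =>
    rw [vert_apply, baseHom_apply_cons]
    by_cases hy : y = x
    · subst hy
      rw [Pi.mulSingle_eq_same, hg.2 w fun hw => hu (List.cons_prefix_cons.2 ⟨rfl, hw⟩)]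
    · rw [Pi.mulSingle_eq_of_ne hy]
      rfl

theorem vert_mem_ristLayer_succ {G : Subgroup (TreeAut X)} (h : VertClosed G) (x : X) {n : ℕ}
    {g : TreeAut X} (hg : g ∈ ristLayer G n) : vert x g ∈ ristLayer G (n + 1) := by
  have key : ristLayer G n ≤ (ristLayer G (n + 1)).comap (vert x) := by
    refine iSup₂_le fun v hv => ?_
    rw [← Subgroup.map_le_iff_le_comap]
    refine (map_vert_rist_le h x v).trans ?_
    exact le_iSup₂_of_le (f := fun (v : List X) (_ : v.length = n + 1) => rist G v)
      (x :: v) (by simp [hv]) le_rfl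
  exact key hg

/-- An element fixing layer `n + 1` is the product over the letters of its first sections, each of
which lies in `G` and fixes layer `n`. With the finite index of layer stabilisers this gives the
branch property. -/
theorem VertClosed.layerStab_inf_le [Finite X] {G : Subgroup (TreeAut X)} (h : VertClosed G)
    (hs : IsSelfSimilar G) (n : ℕ) : layerStab X n ⊓ G ≤ ristLayer G n := by
  induction n with
  | zero =>
    rintro g ⟨-, hg⟩
    refine le_iSup₂ (f := fun (v : List X) (_ : v.length = 0) => rist G v) [] rfl ⟨hg, ?_⟩
    exact fun u hu => (hu List.nil_prefix).elim
  | succ n ih =>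
    rintro g ⟨hgn, hg⟩
    have hl : label g [] = 1 := by
      ext x
      have h1 := hgn (x :: List.replicate n x) (by simp)
      rw [apply_cons] at h1
      simpa using (List.cons.inj h1).1
    rw [eq_baseHom_of_label_nil hl]
    refine baseHom_mem_of_vert_mem (fun x k hk => vert_mem_ristLayer_succ h x hk) fun x => ?_
    refine ih ⟨fun v hv => ?_, hs g hg [x]⟩
    have h1 := hgn (x :: v) (by simp [hv])
    rw [apply_cons] at h1
    exact (List.cons.inj h1).2

theorem VertClosed.isBranch [Finite X] {G : Subgroup (TreeAut X)} (h : VertClosed G)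
    (hs : IsSelfSimilar G) (h1 : ∀ x y : X, ∃ g ∈ G, g.1 [x] = [y]) : IsBranch G := by
  refine ⟨h.isSphericallyTransitive h1, fun n => ?_⟩
  have := finiteIndex_layerStab (X := X) n
  refine Subgroup.finiteIndex_of_le (H := (layerStab X n).subgroupOf G) ?_
  exact fun g hg => h.layerStab_inf_le hs n ⟨hg, g.2⟩

/-- The embedding of `Aut(X*)` as the group of automorphisms that move only vertices
below the word `v`. -/
def vertWord : List X → TreeAut X →* TreeAut X
  | [] => MonoidHom.id _
  | x :: v => (vert x).comp (vertWord v)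

theorem VertClosed.vertWord_mem {G : Subgroup (TreeAut X)} (h : VertClosed G) (v : List X)
    {g : TreeAut X} (hg : g ∈ G) : vertWord v g ∈ G := by
  induction v with
  | nil => exact hg
  | cons x v ih => exact h x _ ih

theorem vertWord_apply_of_length_eq (v : List X) (g : TreeAut X) {u : List X}
    (hu : u.length = v.length) : (vertWord v g).1 u = u := by
  have : vertWord v g ∈ layerStab X v.length := by
    clear hu
    induction v with
    | nil =>
      intro u hu
      rw [List.length_eq_zero_iff.1 hu]
      exact (vertWord [] g).2.1
    | cons x v ih => exact vert_mem_layerStab_succ ih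
  exact this u hu

theorem sect_vertWord_self (v : List X) (g : TreeAut X) : sect (vertWord v g) v = g := by
  induction v with
  | nil => exact sect_nil g
  | cons x v ih =>
    rw [sect_cons]
    change sect (sect (vert x (vertWord v g)) [x]) v = g
    rw [sect_vert_self, ih]

theorem sect_vertWord_of_ne {u v : List X} (hl : u.length = v.length) (h : u ≠ v)
    (g : TreeAut X) : sect (vertWord v g) u = 1 := by
  induction v generalizing u with
  | nil => exact (h (List.length_eq_zero_iff.1 hl)).elim
  | cons x v ih =>
    cases u with
    | nil => simp at hl
    | cons y u =>
      rw [sect_cons]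
      change sect (sect (vert x (vertWord v g)) [y]) u = 1
      rw [sect_vert]
      by_cases hy : y = x
      · subst hy
        rw [Pi.mulSingle_eq_same]
        exact ih (by simpa using hl) fun huv => h (by rw [huv])
      · rw [Pi.mulSingle_eq_of_ne hy, sect_one]

/-- If `n` moves the vertex `v`, the section at `v` of the commutator of `n` with an element
supported below `v` recovers the inverse of that element. -/
theorem sect_commutator_vertWord {n : TreeAut X} {v : List X} (hn : n.1 v ≠ v) (g : TreeAut X) :
    sect (n * vertWord v g * n⁻¹ * (vertWord v g)⁻¹) v = g⁻¹ := by
  have h1 : (vertWord v g)⁻¹.1 v = v := by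
    rw [← map_inv]
    exact vertWord_apply_of_length_eq v _ rfl
  have h2 : n⁻¹.1 v ≠ v := by
    intro h
    apply hn
    conv_lhs => rw [← h]
    simp
  have h3 : (n⁻¹.1 v).length = v.length := TreeAut.length_apply _ _
  rw [sect_mul, h1, sect_mul, sect_mul, vertWord_apply_of_length_eq v g h3,
    sect_vertWord_of_ne h3 h2, mul_one, ← sect_mul, mul_inv_cancel, sect_one, one_mul,
    sect_inv, h1, sect_vertWord_self]

end Vert

/-! ### The rooted copy of `R`. -/

section Rooted

variable (R : Type*) [Group R]

/-- The group `R` as a group of rooted automorphisms. -/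
def rootedMul : R →* TreeAut R := rooted.comp (MulAction.toPermHom R R)

theorem rootedGroup_eq_range : rootedGroup R = (rootedMul R).range := by
  rw [rootedGroup, cayley, MonoidHom.map_range]
  rfl

variable {R}

theorem rootedMul_apply_cons (r x : R) (w : List R) :
    (rootedMul R r).1 (x :: w) = (r * x) :: w := rfl

theorem rootedMul_injective : Function.Injective (rootedMul R) := fun r s h => by
  have h1 : (rootedMul R r).1 [1] = (rootedMul R s).1 [1] := by rw [h]
  simpa [rootedMul_apply_cons] using h1

theorem rootedMul_mem (r : R) : rootedMul R r ∈ rootedGroup R := by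
  rw [rootedGroup_eq_range]
  exact ⟨r, rfl⟩

theorem exists_rootedMul_eq {g : TreeAut R} (hg : g ∈ rootedGroup R) : ∃ r, rootedMul R r = g := by
  rwa [rootedGroup_eq_range] at hg

theorem rooted_mem_rootedGroup {σ : Equiv.Perm R} (hσ : σ ∈ cayley R) :
    rooted σ ∈ rootedGroup R := ⟨σ, hσ, rfl⟩

theorem sect_of_mem_rootedGroup {g : TreeAut R} (hg : g ∈ rootedGroup R) (x : R) :
    sect g [x] = 1 := by
  obtain ⟨r, rfl⟩ := exists_rootedMul_eq hg
  exact sect_rooted_singleton _ x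

theorem eq_one_of_mem_rootedGroup {g : TreeAut R} (hg : g ∈ rootedGroup R)
    (h : g ∈ layerStab R 1) : g = 1 := by
  obtain ⟨r, rfl⟩ := exists_rootedMul_eq hg
  have h1 := h [1] rfl
  rw [rootedMul_apply_cons] at h1
  have hr : r = 1 := by simpa using h1
  rw [hr, map_one]

theorem rootedGroup_le_gammaGroup : rootedGroup R ≤ gammaGroup (cayley R) := by
  rintro _ ⟨σ, hσ, rfl⟩ v
  cases v with
  | nil => rwa [label_rooted_nil]
  | cons x v =>
    rw [label_cons, sect_rooted_singleton, label_one]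
    exact one_mem _

theorem exists_mem_rootedGroup_apply (x y : R) : ∃ g ∈ rootedGroup R, g.1 [x] = [y] :=
  ⟨rootedMul R (y * x⁻¹), rootedMul_mem _, by rw [rootedMul_apply_cons, inv_mul_cancel_right]⟩

end Rooted

/-! ### Contraction to the nucleus and self-similarity. -/

section DirectedGroup

variable {R : Type*} [Group R] {D : Subgroup (TreeAut R)}

theorem rootedGroup_le_spinalGroup : rootedGroup R ≤ spinalGroup D := le_sup_left

theorem le_spinalGroup : D ≤ spinalGroup D := le_sup_right

theorem spinalGroup_transitive_one (x y : R) : ∃ g ∈ spinalGroup D, g.1 [x] = [y] := by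
  obtain ⟨g, hg, h⟩ := exists_mem_rootedGroup_apply x y
  exact ⟨g, rootedGroup_le_spinalGroup hg, h⟩

theorem IsDirectedGroup.sect_mem (hD : IsDirectedGroup D) {d : TreeAut R} (hd : d ∈ D) {x : R}
    (hx : x ≠ 1) : sect d [x] ∈ rootedGroup R := by
  rw [← hD.generation]
  exact Subgroup.subset_closure ⟨d, hd, x, hx, rfl⟩

theorem IsDirectedGroup.eq_one (hD : IsDirectedGroup D) {d : TreeAut R} (hd : d ∈ D)
    (h : d ∈ rootedGroup R) : d = 1 :=
  eq_one_of_mem_rootedGroup h (hD.directed d hd).1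

theorem IsDirectedGroup.spinalGroup_le_gammaGroup (hD : IsDirectedGroup D) :
    spinalGroup D ≤ gammaGroup (cayley R) :=
  sup_le rootedGroup_le_gammaGroup hD.le_gamma

theorem IsDirectedGroup.rooted_label_mem (hD : IsDirectedGroup D) {g : TreeAut R}
    (hg : g ∈ spinalGroup D) : rooted (label g []) ∈ rootedGroup R :=
  rooted_mem_rootedGroup (hD.spinalGroup_le_gammaGroup hg [])

/-- All sections of `g` at the words of length `n` lie in `S`. -/
def sectLevel (S : Set (TreeAut R)) : ℕ → TreeAut R → Prop
  | 0, g => g ∈ S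
  | n + 1, g => ∀ x : R, sectLevel S n (sect g [x])

/-- The nucleus of a constant spinal group. -/
def nucleus (D : Subgroup (TreeAut R)) : Set (TreeAut R) := {g | g ∈ rootedGroup R ∨ g ∈ D}

theorem IsDirectedGroup.sect_mem_nucleus (hD : IsDirectedGroup D) {g : TreeAut R}
    (hg : g ∈ nucleus D) (x : R) : sect g [x] ∈ nucleus D := by
  rcases hg with hg | hg
  · rw [sect_of_mem_rootedGroup hg]
    exact Or.inl (one_mem _)
  · by_cases hx : x = 1
    · subst hx
      rw [(hD.directed g hg).2.1]
      exact Or.inr hg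
    · exact Or.inl (hD.sect_mem hg hx)

theorem IsDirectedGroup.sectLevel_succ (hD : IsDirectedGroup D) (n : ℕ) {g : TreeAut R}
    (hg : sectLevel (nucleus D) n g) : sectLevel (nucleus D) (n + 1) g := by
  induction n generalizing g with
  | zero => exact hD.sect_mem_nucleus hg
  | succ n ih => exact fun x => ih (hg x)

theorem IsDirectedGroup.sectLevel_mono (hD : IsDirectedGroup D) {m n : ℕ} (hmn : m ≤ n)
    {g : TreeAut R} (hg : sectLevel (nucleus D) m g) : sectLevel (nucleus D) n g := by
  induction n, hmn using Nat.le_induction with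
  | base => exact hg
  | succ n _ ih => exact hD.sectLevel_succ n ih

/-- A product costs one level: the nucleus is not closed under products, but in a product of a
rooted and a directed element the rooted factor has trivial sections, so the first sections are
again in the nucleus. -/
theorem IsDirectedGroup.sectLevel_mul (hD : IsDirectedGroup D) (n : ℕ) {g h : TreeAut R}
    (hg : sectLevel (nucleus D) n g) (hh : sectLevel (nucleus D) n h) :
    sectLevel (nucleus D) (n + 1) (g * h) := by
  induction n generalizing g h with
  | zero =>
    intro x
    change sect (g * h) [x] ∈ nucleus D
    rw [sect_mul, apply_singleton]
    rcases hg with hg | hg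
    · rw [sect_of_mem_rootedGroup hg, one_mul]
      exact hD.sect_mem_nucleus hh x
    · rcases hh with hh | hh
      · rw [sect_of_mem_rootedGroup hh, mul_one]
        exact hD.sect_mem_nucleus (Or.inr hg) _
      · rw [← apply_singleton, ← sect_mul]
        exact hD.sect_mem_nucleus (Or.inr (mul_mem hg hh)) x
  | succ n ih =>
    intro x
    rw [sect_mul, apply_singleton]
    exact ih (hg _) (hh x)

theorem sectLevel_nucleus_inv (n : ℕ) {g : TreeAut R} (hg : sectLevel (nucleus D) n g) :
    sectLevel (nucleus D) n g⁻¹ := by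
  induction n generalizing g with
  | zero => exact hg.imp inv_mem inv_mem
  | succ n ih =>
    intro x
    rw [sect_inv, apply_singleton]
    exact ih (hg _)

/-- Every element of a constant spinal group contracts into the nucleus. -/
theorem IsDirectedGroup.exists_sectLevel (hD : IsDirectedGroup D) {g : TreeAut R}
    (hg : g ∈ spinalGroup D) : ∃ n, sectLevel (nucleus D) n g := by
  let S : Subgroup (TreeAut R) :=
    { carrier := {g | ∃ n, sectLevel (nucleus D) n g}
      one_mem' := ⟨0, Or.inl (one_mem _)⟩
      mul_mem' := by
        rintro g h ⟨m, hm⟩ ⟨n, hn⟩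
        exact ⟨max m n + 1, hD.sectLevel_mul _ (hD.sectLevel_mono (le_max_left m n) hm)
          (hD.sectLevel_mono (le_max_right m n) hn)⟩
      inv_mem' := by
        rintro g ⟨n, hn⟩
        exact ⟨n, sectLevel_nucleus_inv n hn⟩ }
  have h : spinalGroup D ≤ S := sup_le (fun g hg => ⟨0, Or.inl hg⟩) fun g hg => ⟨0, Or.inr hg⟩
  exact h hg

/-- The element is its own section at every word `1…1`, so contraction along these words catches it
in the nucleus. -/
theorem IsDirectedGroup.mem_nucleus_of_sect_eq (hD : IsDirectedGroup D) {g : TreeAut R}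
    (hg : g ∈ spinalGroup D) (h : sect g [1] = g) : g ∈ nucleus D := by
  obtain ⟨n, hn⟩ := hD.exists_sectLevel hg
  clear hg
  induction n with
  | zero => exact hn
  | succ n ih => exact ih (h ▸ hn 1)

/-- Subgroups of `D` are recovered from the spinal groups they define. -/
theorem IsDirectedGroup.mem_of_mem_spinalGroup (hD : IsDirectedGroup D)
    {T : Subgroup (TreeAut R)} (hT : IsDirectedGroup T) {d : TreeAut R} (hd : d ∈ D)
    (h : d ∈ spinalGroup T) : d ∈ T := by
  rcases hT.mem_nucleus_of_sect_eq h (hD.directed d hd).2.1 with h1 | h1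
  · rw [hD.eq_one hd h1]
    exact one_mem _
  · exact h1

theorem IsDirectedGroup.sect_mem_spinalGroup (hD : IsDirectedGroup D) {g : TreeAut R}
    (hg : g ∈ spinalGroup D) (x : R) : sect g [x] ∈ spinalGroup D := by
  let S : Subgroup (TreeAut R) :=
    { carrier := {g | ∀ x : R, sect g [x] ∈ spinalGroup D}
      one_mem' := fun x => by
        rw [sect_one]
        exact one_mem _
      mul_mem' := by
        intro g h hg hh x
        rw [sect_mul, apply_singleton]
        exact mul_mem (hg _) (hh x)
      inv_mem' := by
        intro g hg x
        rw [sect_inv, apply_singleton]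
        exact inv_mem (hg _) }
  have hn : ∀ g ∈ nucleus D, g ∈ spinalGroup D := fun g hg =>
    hg.elim (fun h => rootedGroup_le_spinalGroup h) fun h => le_spinalGroup h
  have h : spinalGroup D ≤ S :=
    sup_le (fun g hg x => hn _ (hD.sect_mem_nucleus (Or.inl hg) x))
      fun g hg x => hn _ (hD.sect_mem_nucleus (Or.inr hg) x)
  exact h hg x

theorem IsDirectedGroup.isSelfSimilar (hD : IsDirectedGroup D) :
    IsSelfSimilar (spinalGroup D) := by
  intro g hg v
  induction v generalizing g with
  | nil => rwa [sect_nil]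
  | cons x v ih =>
    rw [sect_cons]
    exact ih _ (hD.sect_mem_spinalGroup hg x)

end DirectedGroup

/-! ### Descent to the nucleus for subgroups above `⟨R ∪ T⟩`. -/

section Maximal

variable {R : Type*} [Group R] [DecidableEq R] {D T : Subgroup (TreeAut R)}

/-- Placing elements below the letter `1` is an injective self-map that misses the non-trivial
rooted elements, since its image fixes the first layer. -/
theorem VertClosed.infinite_spinalGroup [Nontrivial R] (hG : VertClosed (spinalGroup D)) :
    Infinite (spinalGroup D) := by
  by_contra hfin
  rw [not_infinite_iff_finite] at hfin
  let f : spinalGroup D → spinalGroup D := fun g => ⟨vert 1 g.1, hG 1 g.1 g.2⟩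
  have hf : Function.Injective f := fun g h hgh =>
    Subtype.ext (vert_injective 1 (congrArg Subtype.val hgh))
  obtain ⟨r, hr⟩ := exists_ne (1 : R)
  obtain ⟨g, hg⟩ := Finite.surjective_of_injective hf
    ⟨rootedMul R r, rootedGroup_le_spinalGroup (rootedMul_mem r)⟩
  have h1 : rootedMul R r ∈ layerStab R 1 := by
    have h2 : vert 1 g.1 = rootedMul R r := congrArg Subtype.val hg
    rw [← h2]
    exact baseHom_mem_layerStab_one _
  have h2 := h1 [1] rfl
  rw [rootedMul_apply_cons] at h2
  exact hr (by simpa using h2)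

/-- This is the way back up in the descent. After a rooted conjugation moving `x` to `1`, the
elements `d` and `vert 1 d` differ only by rooted sections, and these are available in `⟨R ∪ T⟩`. -/
theorem IsDirectedGroup.spinalGroup_le_of_vert_mem [Finite R] (hD : IsDirectedGroup D)
    (hH : VertClosed (spinalGroup T)) {M : Subgroup (TreeAut R)} (hM : spinalGroup T ≤ M) {x : R}
    (h : ∀ g ∈ spinalGroup D, vert x g ∈ M) : spinalGroup D ≤ M := by
  refine sup_le (rootedGroup_le_spinalGroup.trans hM) fun d hd => ?_
  have h1 : vert 1 d ∈ M := by
    have hr : rootedMul R x⁻¹ ∈ M := hM (rootedGroup_le_spinalGroup (rootedMul_mem _))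
    have h2 := mul_mem (mul_mem hr (h d (le_spinalGroup hd))) (inv_mem hr)
    have h3 := rooted_conj_vert (MulAction.toPermHom R R x⁻¹) x d
    have h4 : (MulAction.toPermHom R R x⁻¹) x = 1 := by simp
    rw [h4] at h3
    rw [← h3]
    exact h2
  have h2 : (vert 1 d)⁻¹ * d ∈ spinalGroup T := by
    have h3 : (vert 1 d)⁻¹ * d = (vert 1 d)⁻¹ * baseHom fun x => sect d [x] :=
      congrArg _ (eq_baseHom_of_label_nil
        (label_nil_of_mem_layerStab_one (hD.directed d hd).1))
    rw [h3, vert_apply, ← map_inv, ← map_mul]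
    refine baseHom_mem_of_vert_mem hH fun y => ?_
    by_cases hy : y = 1
    · subst hy
      simp [(hD.directed d hd).2.1]
    · simp only [Pi.mul_apply, Pi.inv_apply]
      rw [Pi.mulSingle_eq_of_ne hy, inv_one, one_mul]
      exact rootedGroup_le_spinalGroup (hD.sect_mem hd hy)
  have h3 := mul_mem h1 (hM h2)
  rwa [mul_inv_cancel_left] at h3

/-- A subgroup containing `⟨R ∪ T⟩` that is normalised by an element of `⟨R ∪ D⟩` outside
`⟨R ∪ T⟩` contains `⟨R ∪ D⟩`. -/
theorem IsDirectedGroup.spinalGroup_le_of_normalizes [Finite R] (hD : IsDirectedGroup D)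
    (hH : VertClosed (spinalGroup T))
    (hT : ∀ M : Subgroup (TreeAut R), T ≤ M → ∀ d ∈ D, d ∉ T →
      (∀ m ∈ M, d * m * d⁻¹ ∈ M) → D ≤ M)
    {M : Subgroup (TreeAut R)} (hM : spinalGroup T ≤ M) {g : TreeAut R}
    (hg : g ∈ spinalGroup D) (hgT : g ∉ spinalGroup T) (hn : ∀ m ∈ M, g * m * g⁻¹ ∈ M) :
    spinalGroup D ≤ M := by
  obtain ⟨n, hlev⟩ := hD.exists_sectLevel hg
  induction n generalizing g M with
  | zero =>
    rcases hlev with h | h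
    · exact (hgT (rootedGroup_le_spinalGroup h)).elim
    · exact sup_le (rootedGroup_le_spinalGroup.trans hM)
        (hT M (le_spinalGroup.trans hM) g h (fun h' => hgT (le_spinalGroup h')) hn)
  | succ n ih =>
    have hr := hD.rooted_label_mem hg
    set r := rooted (label g []) with hr'
    have hrT : r ∈ spinalGroup T := rootedGroup_le_spinalGroup hr
    have hdec : g = r * baseHom fun x => sect g [x] := eq_rooted_mul_baseHom g
    -- Otherwise `g`, a rooted element times its sections, would lie in `⟨R ∪ T⟩`.
    have hx : ∃ x, sect g [x] ∉ spinalGroup T := by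
      by_contra! hall
      exact hgT (hdec ▸ mul_mem hrT (baseHom_mem_of_vert_mem hH hall))
    obtain ⟨x, hx⟩ := hx
    refine hD.spinalGroup_le_of_vert_mem hH hM (x := x) ?_
    -- The induction continues with the section at `x` and the subgroup of elements whose copy below
    -- `x` lies in `M`; hence `M` is not assumed to lie in `⟨R ∪ D⟩`.
    refine ih (M := M.comap (vert x)) (fun h hh => hM (hH x h hh)) (hD.sect_mem_spinalGroup hg x)
      hx ?_ (hlev x)
    intro m hm
    rw [Subgroup.mem_comap] at hm ⊢
    have h1 := baseHom_conj_vert (fun x => sect g [x]) x m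
    rw [← h1]
    -- The base part of `g` normalises `M`, because `g` does and `r ∈ M`; below `x` it conjugates by
    -- the section of `g`.
    have h2 : (baseHom fun x => sect g [x]) = r⁻¹ * g := by
      conv_rhs => rw [hdec]
      rw [inv_mul_cancel_left]
    rw [h2]
    have h3 := mul_mem (mul_mem (inv_mem (hM hrT)) (hn _ hm)) (hM hrT)
    convert h3 using 1
    group

end Maximal

/-! ### Maximality, trivial core, prodensity and infinite index. -/

section Consequences

variable {R : Type*} [Group R] [DecidableEq R] {D T : Subgroup (TreeAut R)}

theorem IsDirectedGroup.isCoatom [Finite R] (hD : IsDirectedGroup D) (hT : IsDirectedGroup T) (hTD : T < D)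
    (hH : VertClosed (spinalGroup T))
    (hmax : ∀ M : Subgroup (TreeAut R), T ≤ M → ∀ d ∈ D, d ∉ T →
      (∀ m ∈ M, d * m * d⁻¹ ∈ M) → D ≤ M) :
    IsCoatom ((spinalGroup T).subgroupOf (spinalGroup D)) := by
  have hle : spinalGroup T ≤ spinalGroup D := sup_le_sup_left hTD.le _
  constructor
  · intro h
    rw [Subgroup.subgroupOf_eq_top] at h
    obtain ⟨d, hd, hdT⟩ := SetLike.exists_of_lt hTD
    exact hdT (hD.mem_of_mem_spinalGroup hT hd (h (le_spinalGroup hd)))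
  · intro M hM
    obtain ⟨g, hgM, hgT⟩ := SetLike.exists_of_lt hM
    have hM' : spinalGroup T ≤ M.map (spinalGroup D).subtype := fun h hh =>
      ⟨⟨h, hle hh⟩, hM.le hh, rfl⟩
    -- An overgroup is normalised by each of its own elements, in particular by `g`.
    have key := hD.spinalGroup_le_of_normalizes hH hmax hM' g.2 hgT (by
      rintro _ ⟨m, hm, rfl⟩
      exact ⟨g * m * g⁻¹, mul_mem (mul_mem hgM hm) (inv_mem hgM), rfl⟩)
    rw [eq_top_iff]
    rintro k -
    obtain ⟨m, hm, hmk⟩ := key k.2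
    rwa [← Subtype.ext (a1 := m) (a2 := k) hmk]

/-- If `n ∈ N` moves `v`, its commutator with a copy of `d` below `v` stays in `N` and has section
`d⁻¹` at `v`. Self-similarity puts `d` in `⟨R ∪ T⟩`, which is impossible for `d ∉ T`. -/
theorem IsDirectedGroup.eq_bot_of_normal (hD : IsDirectedGroup D) (hT : IsDirectedGroup T)
    (hTD : T < D) (hG : VertClosed (spinalGroup D)) (N : Subgroup (spinalGroup D)) (hN : N.Normal)
    (h : N ≤ (spinalGroup T).subgroupOf (spinalGroup D)) : N = ⊥ := by
  by_contra hne
  obtain ⟨n, hn, hn1⟩ := N.bot_or_exists_ne_one.resolve_left hne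
  have hv : ∃ v, n.1.1 v ≠ v := by
    by_contra! hall
    exact hn1 (Subtype.ext (treeAut_ext hall))
  obtain ⟨v, hv⟩ := hv
  obtain ⟨d, hd, hdT⟩ := SetLike.exists_of_lt hTD
  let a : spinalGroup D := ⟨vertWord v d, hG.vertWord_mem v (le_spinalGroup hd)⟩
  have hc : n * a * n⁻¹ * a⁻¹ ∈ N := by
    have := mul_mem hn (hN.conj_mem _ (inv_mem hn) a)
    convert this using 1
    group
  have h2 := hT.isSelfSimilar _ (h hc) v
  have h3 := sect_commutator_vertWord hv d
  change sect (n.1 * vertWord v d * n.1⁻¹ * (vertWord v d)⁻¹) v ∈ _ at h2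
  rw [h3, inv_mem_iff] at h2
  exact hdT (hD.mem_of_mem_spinalGroup hT hd h2)

theorem isProdense_of_isCoatom {G : Type*} [Group G] {H : Subgroup G} (hH : IsCoatom H)
    (hcore : ∀ N : Subgroup G, N.Normal → N ≤ H → N = ⊥) : IsProdense H := by
  intro N hN hne
  rw [← Subgroup.mul_normal H N, ← Subgroup.coe_top, SetLike.coe_set_eq]
  refine (hH.le_iff.1 le_sup_left).resolve_right fun h => hne (hcore N hN ?_)
  rw [← h]
  exact le_sup_right

theorem not_finiteIndex_of_core_eq_bot {G : Type*} [Group G] [Infinite G] {H : Subgroup G}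
    (hcore : ∀ N : Subgroup G, N.Normal → N ≤ H → N = ⊥) : ¬ H.FiniteIndex := by
  intro h
  have h1 : H.normalCore = ⊥ := hcore _ inferInstance H.normalCore_le
  have h2 : (⊥ : Subgroup G).FiniteIndex := h1 ▸ inferInstance
  exact h2.index_ne_zero (by rw [Subgroup.index_bot, Nat.card_eq_zero_of_infinite])

end Consequences

/-! ### Products of a character over the sections of a level. -/

section ExtendByOne

variable {X C : Type*} [CommGroup C] {D : Subgroup (TreeAut X)}

open Classical in
/-- The extension by `1` of a homomorphism defined on `D`. -/
noncomputable def extendByOne (χ : D →* C) (g : TreeAut X) : C :=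
  -- The value `1` outside `D` is what makes rooted elements contribute nothing.
  if h : g ∈ D then χ ⟨g, h⟩ else 1

theorem extendByOne_of_mem (χ : D →* C) {g : TreeAut X} (h : g ∈ D) :
    extendByOne χ g = χ ⟨g, h⟩ := dif_pos h

theorem extendByOne_mul (χ : D →* C) {g h : TreeAut X} (hg : g ∈ D) (hh : h ∈ D) :
    extendByOne χ (g * h) = extendByOne χ g * extendByOne χ h := by
  rw [extendByOne_of_mem χ hg, extendByOne_of_mem χ hh, extendByOne_of_mem χ (mul_mem hg hh),
    ← map_mul]
  rfl

theorem extendByOne_one (χ : D →* C) : extendByOne χ 1 = 1 := by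
  rw [extendByOne_of_mem χ (one_mem D)]
  exact map_one χ

/-- The product of the values of `χ` at all sections of level `n`. -/
noncomputable def sectProd [Fintype X] (χ : D →* C) : ℕ → TreeAut X → C
  | 0, g => extendByOne χ g
  | n + 1, g => ∏ x : X, sectProd χ n (sect g [x])

theorem sectProd_one [Fintype X] (χ : D →* C) (n : ℕ) : sectProd χ n 1 = 1 := by
  induction n with
  | zero => exact extendByOne_one χ
  | succ n ih =>
    refine Finset.prod_eq_one fun x _ => ?_
    rw [sect_one, ih]

theorem sectProd_vert [Fintype X] [DecidableEq X] (χ : D →* C) (n : ℕ) (x : X)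
    (g : TreeAut X) :
    sectProd χ (n + 1) (vert x g) = sectProd χ n g := by
  change ∏ y : X, sectProd χ n (sect (vert x g) [y]) = _
  rw [Fintype.prod_eq_single x, sect_vert_self]
  intro y hy
  rw [sect_vert, Pi.mulSingle_eq_of_ne hy, sectProd_one]

end ExtendByOne

/-! ### Extending characters of `D` and failure of the congruence subgroup property. -/

section Abelianization

variable {R : Type*} [Group R] {D : Subgroup (TreeAut R)} {C : Type*} [CommGroup C]

theorem sectLevel_vert [DecidableEq R] (n : ℕ) (x : R) {g : TreeAut R} (hg : sectLevel (nucleus D) n g) :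
    sectLevel (nucleus D) (n + 1) (vert x g) := by
  intro y
  rw [sect_vert]
  by_cases hy : y = x
  · subst hy
    rwa [Pi.mulSingle_eq_same]
  · rw [Pi.mulSingle_eq_of_ne hy]
    clear hg
    induction n with
    | zero => exact Or.inl (one_mem _)
    | succ n ih =>
      intro z
      rw [sect_one]
      exact ih

theorem IsDirectedGroup.extendByOne_of_mem_rootedGroup (hD : IsDirectedGroup D) (χ : D →* C)
    {g : TreeAut R} (hg : g ∈ rootedGroup R) : extendByOne χ g = 1 := by
  by_cases h : g ∈ D
  · rw [hD.eq_one h hg, extendByOne_one]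
  · exact dif_neg h

variable [Fintype R] (χ : D →* C)

/-- Once in the nucleus the product is stable: a directed element reproduces itself at the letter
`1` and contributes only rooted sections elsewhere. -/
theorem IsDirectedGroup.sectProd_succ (hD : IsDirectedGroup D) (n : ℕ) {g : TreeAut R}
    (hg : sectLevel (nucleus D) n g) : sectProd χ (n + 1) g = sectProd χ n g := by
  induction n generalizing g with
  | zero =>
    change ∏ x : R, extendByOne χ (sect g [x]) = extendByOne χ g
    rcases hg with hg | hg
    · rw [hD.extendByOne_of_mem_rootedGroup χ hg]
      refine Finset.prod_eq_one fun x _ => ?_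
      rw [sect_of_mem_rootedGroup hg, extendByOne_one]
    · rw [Fintype.prod_eq_single 1, (hD.directed g hg).2.1]
      exact fun x hx => hD.extendByOne_of_mem_rootedGroup χ (hD.sect_mem hg hx)
  | succ n ih => exact Finset.prod_congr rfl fun x _ => ih (hg x)

theorem IsDirectedGroup.sectProd_eq_of_le (hD : IsDirectedGroup D) {m n : ℕ} (hmn : m ≤ n)
    {g : TreeAut R} (hg : sectLevel (nucleus D) m g) : sectProd χ n g = sectProd χ m g := by
  induction n, hmn using Nat.le_induction with
  | base => rfl
  | succ n hn ih => rw [hD.sectProd_succ χ n (hD.sectLevel_mono hn hg), ih]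

theorem IsDirectedGroup.sectProd_mul (hD : IsDirectedGroup D) (n : ℕ) {g h : TreeAut R}
    (hg : sectLevel (nucleus D) n g) (hh : sectLevel (nucleus D) n h) :
    sectProd χ (n + 1) (g * h) = sectProd χ (n + 1) g * sectProd χ (n + 1) h := by
  have reindex : ∀ (m : ℕ) (g h : TreeAut R),
      (∀ x y, sectProd χ m (sect g [x] * sect h [y]) =
        sectProd χ m (sect g [x]) * sectProd χ m (sect h [y])) →
      sectProd χ (m + 1) (g * h) = sectProd χ (m + 1) g * sectProd χ (m + 1) h := by
    intro m g h H
    change ∏ x : R, sectProd χ m (sect (g * h) [x]) =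
      (∏ x : R, sectProd χ m (sect g [x])) * ∏ x : R, sectProd χ m (sect h [x])
    -- The sections of `g` occur permuted by the label of `h`; commutativity of `C` absorbs this.
    rw [← Equiv.prod_comp (label h []) fun x => sectProd χ m (sect g [x]),
      ← Finset.prod_mul_distrib]
    refine Finset.prod_congr rfl fun x _ => ?_
    rw [sect_mul, apply_singleton, H]
  induction n generalizing g h with
  | zero =>
    have hr : ∀ {k : TreeAut R}, k ∈ rootedGroup R → sectProd χ 1 k = 1 := fun hk => by
      rw [hD.sectProd_succ χ 0 (Or.inl hk)]
      exact hD.extendByOne_of_mem_rootedGroup χ hk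
    rcases hg with hg | hg
    · rcases hh with hh | hh
      · rw [hr hg, hr hh, hr (mul_mem hg hh), one_mul]
      · refine reindex 0 g h fun x y => ?_
        rw [sect_of_mem_rootedGroup hg, one_mul, sectProd_one, one_mul]
    · rcases hh with hh | hh
      · refine reindex 0 g h fun x y => ?_
        rw [sect_of_mem_rootedGroup hh, mul_one, sectProd_one, mul_one]
      · rw [hD.sectProd_succ χ 0 (Or.inr hg), hD.sectProd_succ χ 0 (Or.inr hh),
          hD.sectProd_succ χ 0 (Or.inr (mul_mem hg hh))]
        exact extendByOne_mul χ hg hh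
  | succ n ih => exact reindex _ g h fun x y => ih (hg x) (hh y)

/-- The extension to `⟨R ∪ D⟩` of a homomorphism from `D` to a commutative group. -/
theorem IsDirectedGroup.exists_extension (hD : IsDirectedGroup D) :
    ∃ f : spinalGroup D →* C, ∀ (g : spinalGroup D) (n : ℕ), sectLevel (nucleus D) n g.1 →
      f g = sectProd χ n g.1 := by
  choose N hN using fun g : spinalGroup D => hD.exists_sectLevel g.2
  -- The value does not depend on the level, provided all sections there are in the nucleus.
  have key : ∀ (g : spinalGroup D) (n : ℕ), sectLevel (nucleus D) n g.1 →
      sectProd χ (N g) g.1 = sectProd χ n g.1 := fun g n hn => by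
    rw [← hD.sectProd_eq_of_le χ (le_max_left (N g) n) (hN g),
      ← hD.sectProd_eq_of_le χ (le_max_right (N g) n) hn]
  refine ⟨MonoidHom.mk' (fun g => sectProd χ (N g) g.1) fun g h => ?_, key⟩
  have hg := hD.sectLevel_mono (le_max_left (N g) (N h)) (hN g)
  have hh := hD.sectLevel_mono (le_max_right (N g) (N h)) (hN h)
  rw [key (g * h) _ (hD.sectLevel_mul _ hg hh), key g _ (hD.sectLevel_succ _ hg),
    key h _ (hD.sectLevel_succ _ hh)]
  exact hD.sectProd_mul χ _ hg hh

variable [DecidableEq R]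

/-- The map `vert 1` preserves the value of the extended character and deepens the layer fixed by
one. So every layer stabiliser contains an element outside the finite-index kernel. -/
theorem IsDirectedGroup.not_hasCSP (hD : IsDirectedGroup D) (hG : VertClosed (spinalGroup D))
    [Finite C] (hχ : ∃ d, χ d ≠ 1) : ¬ HasCSP (spinalGroup D) := by
  intro hcsp
  obtain ⟨f, hf⟩ := hD.exists_extension χ
  obtain ⟨n, hn⟩ := hcsp f.ker inferInstance inferInstance
  obtain ⟨d, hd⟩ := hχ
  have key : ∃ g ∈ spinalGroup D, g ∈ layerStab R n ∧ sectLevel (nucleus D) n g ∧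
      sectProd χ n g = χ d := by
    clear hn
    induction n with
    | zero =>
      refine ⟨d, le_spinalGroup d.2, ?_, Or.inr d.2, extendByOne_of_mem χ d.2⟩
      intro v hv
      rw [List.length_eq_zero_iff.1 hv]
      exact d.1.2.1
    | succ n ih =>
      obtain ⟨g, hg, hg1, hg2, hg3⟩ := ih
      exact ⟨vert 1 g, hG 1 g hg, vert_mem_layerStab_succ hg1, sectLevel_vert n 1 hg2,
        by rw [sectProd_vert, hg3]⟩
  obtain ⟨g, hg, hg1, hg2, hg3⟩ := key
  apply hd
  rw [← hg3, ← hf ⟨g, hg⟩ n hg2]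
  exact MonoidHom.mem_ker.1 (hn (x := ⟨g, hg⟩) hg1)

end Abelianization

/-! ### Building directed groups, and the commutator trick. -/

section Construction

variable {R : Type*} [Group R] [DecidableEq R]

/-- The action of the directed automorphism with rooted sections `q x` at the letters `x ≠ 1`. -/
def directedFun (q : R → R) : List R → List R
  | [] => []
  | x :: w => x :: if x = 1 then directedFun q w else (rootedMul R (q x)).1 w

theorem directedFun_mul (p q : R → R) (w : List R) :
    directedFun (p * q) w = directedFun p (directedFun q w) := by
  induction w with
  | nil => rfl
  | cons x w ih =>
    simp only [directedFun]
    by_cases hx : x = 1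
    · simp [hx, ih]
    · simp [hx]

theorem directedFun_one (w : List R) : directedFun 1 w = w := by
  induction w with
  | nil => rfl
  | cons x w ih =>
    simp only [directedFun]
    by_cases hx : x = 1
    · simp [hx, ih]
    · simp [hx]

theorem directedFun_append_singleton (q : R → R) (u : List R) (x : R) :
    ∃ y, directedFun q (u ++ [x]) = directedFun q u ++ [y] := by
  induction u with
  | nil =>
    refine ⟨x, ?_⟩
    simp only [List.nil_append, directedFun]
    split_ifs
    · rfl
    · rw [(rootedMul R (q x)).2.1]
  | cons z u ih =>
    simp only [List.cons_append, directedFun]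
    split_ifs
    · obtain ⟨y, hy⟩ := ih
      exact ⟨y, by rw [hy]⟩
    · obtain ⟨y, hy⟩ := (rootedMul R (q z)).2.2 u x
      exact ⟨y, by rw [hy]⟩

/-- The directed automorphism with rooted sections `q x` at the letters `x ≠ 1`. -/
def directed : (R → R) →* TreeAut R where
  toFun q :=
    ⟨{ toFun := directedFun q
       invFun := directedFun q⁻¹
       left_inv := fun w => by rw [← directedFun_mul, inv_mul_cancel, directedFun_one]
       right_inv := fun w => by rw [← directedFun_mul, mul_inv_cancel, directedFun_one] },
     rfl, directedFun_append_singleton q⟩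
  map_one' := treeAut_ext directedFun_one
  map_mul' p q := treeAut_ext (directedFun_mul p q)

theorem directed_eq_baseHom (q : R → R) :
    directed q = baseHom fun x => if x = 1 then directed q else rootedMul R (q x) := by
  refine treeAut_ext fun u => ?_
  cases u with
  | nil => rfl
  | cons x w =>
    rw [baseHom_apply_cons]
    by_cases hx : x = 1
    · simp only [if_pos hx]
      change x :: ite _ _ _ = _
      rw [if_pos hx]
      rfl
    · simp only [if_neg hx]
      change x :: ite _ _ _ = _
      rw [if_neg hx]

theorem sect_directed_one (q : R → R) : sect (directed q) [1] = directed q := by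
  conv_lhs => rw [directed_eq_baseHom, sect_baseHom_singleton, if_pos rfl]

theorem sect_directed_of_ne (q : R → R) {x : R} (hx : x ≠ 1) :
    sect (directed q) [x] = rootedMul R (q x) := by
  rw [directed_eq_baseHom, sect_baseHom_singleton, if_neg hx]

theorem directed_mem_layerStab_one (q : R → R) : directed q ∈ layerStab R 1 := by
  rw [directed_eq_baseHom]
  exact baseHom_mem_layerStab_one _

theorem isDirected_directed (q : R → R) : IsDirected (directed q) :=
  ⟨directed_mem_layerStab_one q, sect_directed_one q, fun x hx => by
    rw [sect_directed_of_ne q hx]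
    exact ⟨_, rfl⟩⟩

theorem directed_mem_gammaGroup (q : R → R) : directed q ∈ gammaGroup (cayley R) := by
  intro v
  induction v with
  | nil =>
    rw [label_nil_of_mem_layerStab_one (directed_mem_layerStab_one q)]
    exact one_mem _
  | cons x v ih =>
    rw [label_cons]
    by_cases hx : x = 1
    · rwa [hx, sect_directed_one]
    · rw [sect_directed_of_ne q hx]
      exact rootedGroup_le_gammaGroup (rootedMul_mem _) v

theorem apply_eq_of_directed_eq {p q : R → R} (h : directed p = directed q) {x : R}
    (hx : x ≠ 1) : p x = q x :=
  rootedMul_injective (by rw [← sect_directed_of_ne p hx, h, sect_directed_of_ne q hx])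

variable {A : Type*} [Group A] (φ : A →* (R → R)) (B : Subgroup A)

theorem isDirectedGroup_map
    (hgen : Subgroup.closure {r : R | ∃ a ∈ B, ∃ x : R, x ≠ 1 ∧ r = φ a x} = ⊤) :
    IsDirectedGroup (B.map (directed.comp φ)) where
  le_gamma := by
    rintro _ ⟨a, -, rfl⟩
    exact directed_mem_gammaGroup _
  directed := by
    rintro _ ⟨a, -, rfl⟩
    exact isDirected_directed _
  generation := by
    rw [rootedGroup_eq_range, MonoidHom.range_eq_map, ← hgen, MonoidHom.map_closure]
    congr 1
    ext s
    constructor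
    · rintro ⟨_, ⟨a, ha, rfl⟩, x, hx, rfl⟩
      exact ⟨φ a x, ⟨a, ha, x, hx, rfl⟩, (sect_directed_of_ne _ hx).symm⟩
    · rintro ⟨_, ⟨a, ha, x, hx, rfl⟩, rfl⟩
      exact ⟨_, ⟨a, ha, rfl⟩, x, hx, (sect_directed_of_ne _ hx).symm⟩

/-- The commutator of `directed q` with a rooted conjugate of itself, when `q` is supported on two
letters in general position. -/
theorem commutator_directed {q : R → R} {s t : R} (hs : s ≠ 1) (ht : t ≠ 1)
    (hq : ∀ x, x ≠ s → x ≠ t → q x = 1) (hst : s ≠ t) (htt : s ≠ t * t) (hss : s * s ≠ t)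
    (hs' : (s * t⁻¹) * (s * t⁻¹) ≠ 1) :
    ⁅directed q, rootedMul R (s * t⁻¹) * directed q * (rootedMul R (s * t⁻¹))⁻¹⁆ =
      vert s (rootedMul R ⁅q s, q t⁆) := by
  have hconj := rooted_conj_baseHom (MulAction.toPermHom R R (s * t⁻¹))
    fun x => if x = 1 then directed q else rootedMul R (q x)
  rw [← directed_eq_baseHom] at hconj
  change rootedMul R (s * t⁻¹) * directed q * (rootedMul R (s * t⁻¹))⁻¹ = _ at hconj
  rw [hconj]
  conv_lhs => rw [directed_eq_baseHom q, ← map_commutatorElement]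
  rw [vert_apply]
  congr 1
  funext x
  have hinv : ((MulAction.toPermHom R R (s * t⁻¹))⁻¹ : Equiv.Perm R) x = t * s⁻¹ * x := by
    rw [← map_inv]
    simp
  have hval : ∀ f g : R → TreeAut R, ⁅f, g⁆ x = ⁅f x, g x⁆ := fun _ _ => rfl
  rw [hval, hinv]
  -- The section at `x` is the commutator of the sections of `directed q` at `x` and at `t * s⁻¹ *
  -- x`. Only `1`, `s`, `t` can carry non-trivial sections, and general position leaves `x = s` as
  -- the only letter where both can be non-trivial.
  by_cases hx : x = s
  · subst hx
    rw [Pi.mulSingle_eq_same, if_neg hs, inv_mul_cancel_right, if_neg ht, map_commutatorElement]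
  rw [Pi.mulSingle_eq_of_ne hx]
  by_cases hx1 : x = 1
  · subst hx1
    have h1 : t * s⁻¹ * 1 ≠ 1 := fun h => hst (by
      rw [mul_one, mul_inv_eq_one] at h
      exact h.symm)
    have h2 : t * s⁻¹ * 1 ≠ s := fun h => hss (by
      rw [mul_one, mul_inv_eq_iff_eq_mul] at h
      exact h.symm)
    have h3 : t * s⁻¹ * 1 ≠ t := fun h => hs (by simpa using h)
    rw [if_neg h1, hq _ h2 h3, map_one, commutatorElement_one_right]
  by_cases hxt : x = t
  · subst hxt
    have h1 : x * s⁻¹ * x ≠ 1 := fun h => htt (by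
      have h' : s = x * (x * s⁻¹ * x)⁻¹ * x := by group
      rwa [h, inv_one, mul_one] at h')
    have h2 : x * s⁻¹ * x ≠ s := fun h => hs' (by
      have h' : s * x⁻¹ * (s * x⁻¹) = s * (x * s⁻¹ * x)⁻¹ := by group
      rw [h', h, mul_inv_cancel])
    have h3 : x * s⁻¹ * x ≠ x := fun h => hst (by
      have h' : s = x * (x * s⁻¹ * x)⁻¹ * x := by group
      rw [h', h]
      group)
    rw [if_neg h1, hq _ h2 h3, map_one, commutatorElement_one_right]
  · rw [if_neg hx1, hq x hx hxt, map_one, commutatorElement_one_left]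

/-- A constant spinal group over a simple group contains the coordinate subgroups of its own
direct power, provided that some element of the directed group has two non-trivial rooted sections
in general position that do not commute. -/
theorem vertClosed_spinalGroup [IsSimpleGroup R] {s t : R} (hs : s ≠ 1) (ht : t ≠ 1)
    (hφ : ∀ a x, x ≠ s → x ≠ t → φ a x = 1) (hst : s ≠ t) (htt : s ≠ t * t) (hss : s * s ≠ t)
    (hs' : (s * t⁻¹) * (s * t⁻¹) ≠ 1) {a : A} (ha : a ∈ B) (hcomm : ⁅φ a s, φ a t⁆ ≠ 1)
    (hgen : Subgroup.closure {r : R | ∃ a ∈ B, ∃ x : R, x ≠ 1 ∧ r = φ a x} = ⊤) [Finite R] :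
    VertClosed (spinalGroup (B.map (directed.comp φ))) := by
  set D := B.map (directed.comp φ) with hD
  set G := spinalGroup D with hG
  have hR : ∀ r, rootedMul R r ∈ G := fun r => rootedGroup_le_spinalGroup (rootedMul_mem r)
  have hdir : ∀ b ∈ B, directed (φ b) ∈ G := fun b hb => le_spinalGroup ⟨b, hb, rfl⟩
  have hmove : ∀ (x y : R) (g : TreeAut R), vert x g ∈ G → vert y g ∈ G := fun x y g hg => by
    have h1 := rooted_conj_vert (MulAction.toPermHom R R (y * x⁻¹)) x g
    have h2 : (MulAction.toPermHom R R (y * x⁻¹)) x = y := by simp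
    rw [h2] at h1
    rw [← h1]
    exact mul_mem (mul_mem (hR (y * x⁻¹)) hg) (inv_mem (hR (y * x⁻¹)))
  -- `K` collects the `r` whose rooted copy below `s` lies in `G`. Conjugating by directed elements
  -- below a letter `x ≠ 1` shows that the rooted sections, which generate `R`, normalise `K`.
  let K : Subgroup R := G.comap ((vert s).comp (rootedMul R))
  have hK : ∀ k, k ∈ K ↔ vert s (rootedMul R k) ∈ G := fun k => Iff.rfl
  have hnorm : K.Normal := by
    rw [← Subgroup.normalizer_eq_top_iff, eq_top_iff, ← hgen, Subgroup.closure_le]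
    have hle : ∀ b ∈ B, ∀ x : R, x ≠ 1 → ∀ k ∈ K, φ b x * k * (φ b x)⁻¹ ∈ K := by
      intro b hb x hx k hk
      rw [hK] at hk ⊢
      apply hmove x
      have h1 := baseHom_conj_vert
        (fun x => if x = 1 then directed (φ b) else rootedMul R (φ b x)) x (rootedMul R k)
      rw [← directed_eq_baseHom, if_neg hx, ← map_mul, ← map_inv (rootedMul R), ← map_mul] at h1
      rw [← h1]
      exact mul_mem (mul_mem (hdir b hb) (hmove s x _ hk)) (inv_mem (hdir b hb))
    rintro _ ⟨b, hb, x, hx, rfl⟩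
    rw [SetLike.mem_coe, Subgroup.mem_normalizer_iff]
    refine fun k => ⟨hle b hb x hx k, fun hk => ?_⟩
    have h1 := hle b⁻¹ (inv_mem hb) x hx _ hk
    rw [map_inv, Pi.inv_apply] at h1
    simpa [mul_assoc] using h1
  have hKtop : K = ⊤ := by
    -- The commutator element provides a non-trivial member of `K`, so simplicity of `R` gives all
    -- of `R`.
    refine (hnorm.eq_bot_or_eq_top).resolve_left fun hbot => hcomm ?_
    rw [← Subgroup.mem_bot, ← hbot, hK,
      ← commutator_directed hs ht (hφ a) hst htt hss hs']
    have h1 := hdir a ha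
    have h2 := mul_mem (mul_mem (hR (s * t⁻¹)) h1) (inv_mem (hR (s * t⁻¹)))
    exact mul_mem (mul_mem (mul_mem h1 h2) (inv_mem h1)) (inv_mem h2)
  have hroot : ∀ x r, vert x (rootedMul R r) ∈ G := fun x r =>
    hmove s x _ ((hK r).1 (hKtop ▸ Subgroup.mem_top r))
  have hdirv : ∀ b ∈ B, vert 1 (directed (φ b)) ∈ G := by
    intro b hb
    -- This quotient has only rooted sections, whose copies are already in `G`.
    have h1 : directed (φ b) * (vert 1 (directed (φ b)))⁻¹ ∈ G := by
      have h2 : directed (φ b) * (vert 1 (directed (φ b)))⁻¹ =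
          baseHom fun x => rootedMul R (if x = 1 then 1 else φ b x) := by
        conv_lhs =>
          enter [1]
          rw [directed_eq_baseHom]
        rw [vert_apply, ← map_inv, ← map_mul]
        congr 1
        funext x
        by_cases hx : x = 1
        · subst hx
          simp
        · simp [hx]
      rw [h2]
      refine baseHom_mem_of_vert_mem (K := rootedGroup R) (fun x g hg => ?_)
        fun x => rootedMul_mem _
      obtain ⟨r, rfl⟩ := exists_rootedMul_eq hg
      exact hroot x r
    have h2 := mul_mem (inv_mem h1) (hdir b hb)
    simpa using h2
  intro x
  have hle : G ≤ G.comap (vert x) := by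
    refine sup_le (fun g hg => ?_) ?_
    · obtain ⟨r, rfl⟩ := exists_rootedMul_eq hg
      exact hroot x r
    · rintro _ ⟨b, hb, rfl⟩
      exact hmove 1 x _ (hdirv b hb)
  exact fun g hg => hle hg

end Construction

/-! ### The explicit example over `Alt(5)`. -/

section AltFive

/-- The inclusion of the first four letters. -/
def finFourEquiv : Fin 4 ≃ {x : Fin 5 // x.1 < 4} where
  toFun i := ⟨i.castSucc, i.2⟩
  invFun x := ⟨x.1.1, x.2⟩
  left_inv _ := rfl
  right_inv _ := rfl

/-- The standard embedding of `Alt(4)` into `Alt(5)`. -/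
def altFourEmb : alternatingGroup (Fin 4) →* alternatingGroup (Fin 5) :=
  ((Equiv.Perm.extendDomainHom finFourEquiv).comp (alternatingGroup (Fin 4)).subtype).codRestrict _
    fun σ => by
      rw [Equiv.Perm.mem_alternatingGroup]
      change Equiv.Perm.sign (Equiv.Perm.extendDomain σ.1 finFourEquiv) = 1
      rw [Equiv.Perm.sign_extendDomain]
      exact σ.2

theorem altFourEmb_injective : Function.Injective altFourEmb := fun _ _ h =>
  Subtype.ext (Equiv.Perm.extendDomainHom_injective finFourEquiv (congrArg Subtype.val h))

/-- The three-cycle `(0 1 2)` in `Alt(4)`. -/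
def threeCycle : alternatingGroup (Fin 4) :=
  ⟨Equiv.swap 0 1 * Equiv.swap 1 2, Equiv.Perm.mem_alternatingGroup.2 (by decide)⟩

/-- The three-cycle `(0 1 2)` in `Alt(5)`. -/
def firstCycle : alternatingGroup (Fin 5) :=
  ⟨Equiv.swap 0 1 * Equiv.swap 1 2, Equiv.Perm.mem_alternatingGroup.2 (by decide)⟩

/-- The three-cycle `(2 3 4)` in `Alt(5)`. -/
def secondCycle : alternatingGroup (Fin 5) :=
  ⟨Equiv.swap 2 3 * Equiv.swap 3 4, Equiv.Perm.mem_alternatingGroup.2 (by decide)⟩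

/-- A five-cycle conjugating `(0 1 2)` into `(2 3 4)`. -/
def fiveCycle : alternatingGroup (Fin 5) :=
  ⟨finRotate 5 * finRotate 5, Equiv.Perm.mem_alternatingGroup.2 (by decide)⟩

theorem altFourEmb_threeCycle : altFourEmb threeCycle = firstCycle := by decide

theorem fiveCycle_conj_firstCycle : fiveCycle * firstCycle * fiveCycle⁻¹ = secondCycle := by
  decide

/-- Elements of orders 2, 3 and 5 force the order to be divisible by 30, so the index in a group of
order 60 is at most 2. An index 2 subgroup would be normal, against simplicity. -/
theorem closure_firstCycle_secondCycle :
    Subgroup.closure {firstCycle, secondCycle} = (⊤ : Subgroup (alternatingGroup (Fin 5))) := by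
  set K := Subgroup.closure {firstCycle, secondCycle} with hK
  have ha : firstCycle ∈ K := Subgroup.subset_closure (by simp)
  have hb : secondCycle ∈ K := Subgroup.subset_closure (by simp)
  have hdvd : ∀ (p : ℕ) [Fact p.Prime] (g : alternatingGroup (Fin 5)), g ∈ K → g ^ p = 1 →
      g ≠ 1 → p ∣ Nat.card K := fun p _ g hg h1 h2 => by
    rw [← orderOf_eq_prime h1 h2, ← Subgroup.orderOf_mk g hg]
    exact orderOf_dvd_natCard _
  have h2 : 2 ∣ Nat.card K := by
    have : Fact (Nat.Prime 2) := ⟨Nat.prime_two⟩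
    exact hdvd 2 (firstCycle * secondCycle * firstCycle * secondCycle⁻¹)
      (mul_mem (mul_mem (mul_mem ha hb) ha) (inv_mem hb)) (by decide) (by decide)
  have h3 : 3 ∣ Nat.card K := by
    have : Fact (Nat.Prime 3) := ⟨Nat.prime_three⟩
    exact hdvd 3 firstCycle ha (by decide) (by decide)
  have h5 : 5 ∣ Nat.card K := by
    have : Fact (Nat.Prime 5) := ⟨Nat.prime_five⟩
    exact hdvd 5 (firstCycle * secondCycle) (mul_mem ha hb) (by decide) (by decide)
  have hcard : Nat.card (alternatingGroup (Fin 5)) = 60 := by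
    rw [nat_card_alternatingGroup, Nat.card_eq_fintype_card, Fintype.card_fin]
    rfl
  have hmul := K.card_mul_index
  rw [hcard] at hmul
  have h30 : 30 ∣ Nat.card K :=
    (Nat.Coprime.mul_dvd_of_dvd_of_dvd (by norm_num)
      (Nat.Coprime.mul_dvd_of_dvd_of_dvd (by norm_num) h2 h3) h5)
  obtain ⟨c, hc⟩ := h30
  rw [hc] at hmul
  have hi : K.index = 1 ∨ K.index = 2 := by
    have h4 : c * K.index = 2 := by
      rw [mul_assoc] at hmul
      omega
    exact (Nat.dvd_prime Nat.prime_two).1 (Dvd.intro_left c h4)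
  rcases hi with hi | hi
  · exact Subgroup.index_eq_one.1 hi
  · rcases (Subgroup.normal_of_index_eq_two hi).eq_bot_or_eq_top with h | h
    · rw [h, Subgroup.mem_bot] at ha
      exact absurd ha (by decide)
    · exact h

/-- The rooted sections of the directed automorphism attached to an element of `Alt(4)`: the
standard embedding at the letter `(0 1 2)` and a conjugate of it at the letter `(2 3 4)`. -/
def altFourSections :
    alternatingGroup (Fin 4) →* (alternatingGroup (Fin 5) → alternatingGroup (Fin 5)) :=
  MonoidHom.pi fun x =>
    if x = firstCycle then altFourEmb
    else if x = secondCycle then (MulAut.conj fiveCycle).toMonoidHom.comp altFourEmb else 1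

theorem firstCycle_ne_one : firstCycle ≠ 1 := by decide

theorem secondCycle_ne_one : secondCycle ≠ 1 := by decide

theorem firstCycle_ne_secondCycle : firstCycle ≠ secondCycle := by decide

theorem altFourSections_firstCycle (σ : alternatingGroup (Fin 4)) :
    altFourSections σ firstCycle = altFourEmb σ := by
  simp [altFourSections]

theorem altFourSections_secondCycle (σ : alternatingGroup (Fin 4)) :
    altFourSections σ secondCycle = fiveCycle * altFourEmb σ * fiveCycle⁻¹ := by
  simp [altFourSections, firstCycle_ne_secondCycle.symm]

theorem altFourSections_of_ne (σ : alternatingGroup (Fin 4)) (x : alternatingGroup (Fin 5))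
    (h1 : x ≠ firstCycle) (h2 : x ≠ secondCycle) : altFourSections σ x = 1 := by
  simp [altFourSections, h1, h2]

theorem closure_altFourSections {B : Subgroup (alternatingGroup (Fin 4))} (hB : threeCycle ∈ B) :
    Subgroup.closure {r | ∃ a ∈ B, ∃ x : alternatingGroup (Fin 5), x ≠ 1 ∧
      r = altFourSections a x} = ⊤ := by
  rw [eq_top_iff, ← closure_firstCycle_secondCycle]
  refine Subgroup.closure_mono ?_
  rintro r (rfl | rfl)
  · exact ⟨threeCycle, hB, firstCycle, firstCycle_ne_one, by
      rw [altFourSections_firstCycle, altFourEmb_threeCycle]⟩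
  · exact ⟨threeCycle, hB, secondCycle, secondCycle_ne_one, by
      rw [altFourSections_secondCycle, altFourEmb_threeCycle, fiveCycle_conj_firstCycle]⟩

theorem directed_altFourSections_injective :
    Function.Injective (directed.comp altFourSections) := fun σ τ h => altFourEmb_injective (by
  rw [← altFourSections_firstCycle, ← altFourSections_firstCycle]
  exact apply_eq_of_directed_eq h firstCycle_ne_one)

theorem isDirectedGroup_altFour {B : Subgroup (alternatingGroup (Fin 4))} (hB : threeCycle ∈ B) :
    IsDirectedGroup (B.map (directed.comp altFourSections)) :=
  isDirectedGroup_map _ B (closure_altFourSections hB)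

/-- The non-commuting sections come from `threeCycle` alone, so the result serves both `G` and `H`.
-/
theorem vertClosed_altFour {B : Subgroup (alternatingGroup (Fin 4))} (hB : threeCycle ∈ B) :
    VertClosed (spinalGroup (B.map (directed.comp altFourSections))) := by
  refine vertClosed_spinalGroup altFourSections B firstCycle_ne_one secondCycle_ne_one
    altFourSections_of_ne firstCycle_ne_secondCycle (by decide) (by decide) (by decide) hB ?_
    (closure_altFourSections hB)
  rw [altFourSections_firstCycle, altFourSections_secondCycle, altFourEmb_threeCycle,
    fiveCycle_conj_firstCycle]
  decide

theorem threeCycle_pow_three : threeCycle ^ 3 = 1 := by decide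

theorem orderOf_threeCycle : orderOf threeCycle = 3 := by
  have : Fact (Nat.Prime 3) := ⟨Nat.prime_three⟩
  exact orderOf_eq_prime threeCycle_pow_three (by decide)

set_option maxRecDepth 100000 in
/-- A three-cycle and a conjugate by an element not normalising it generate `Alt(4)`. -/
theorem eq_threeCycle_word (d x : alternatingGroup (Fin 4)) :
    (∃ i : Fin 3, d = threeCycle ^ i.1) ∨ ∃ i j k : Fin 3,
      x = threeCycle ^ i.1 * (d * threeCycle * d⁻¹) ^ j.1 * threeCycle ^ k.1 := by
  revert d x
  decide +kernel

theorem eq_top_of_threeCycle_mem {M : Subgroup (alternatingGroup (Fin 4))} (h : threeCycle ∈ M)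
    {d : alternatingGroup (Fin 4)} (hd : d ∉ Subgroup.zpowers threeCycle)
    (hdM : d * threeCycle * d⁻¹ ∈ M) : M = ⊤ := by
  rw [Subgroup.eq_top_iff']
  intro x
  rcases eq_threeCycle_word d x with ⟨i, rfl⟩ | ⟨i, j, k, rfl⟩
  · exact (hd (Subgroup.npow_mem_zpowers _ _)).elim
  · exact mul_mem (mul_mem (pow_mem h _) (pow_mem hdM _)) (pow_mem h _)

/-- The commutators lie in the Klein four-group of elements with trivial square. This supplies the
character of `D` that defeats the congruence subgroup property. -/
theorem threeCycle_notMem_commutator : threeCycle ∉ commutator (alternatingGroup (Fin 4)) := by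
  let V : Subgroup (alternatingGroup (Fin 4)) :=
    { carrier := {σ | σ * σ = 1}
      one_mem' := one_mul 1
      mul_mem' := by
        have h : ∀ σ τ : alternatingGroup (Fin 4), σ * σ = 1 → τ * τ = 1 →
          σ * τ * (σ * τ) = 1 := by decide +kernel
        exact fun {σ τ} hσ hτ => h σ τ hσ hτ
      inv_mem' := fun {σ} hσ => by
        change σ⁻¹ * σ⁻¹ = 1
        rw [← mul_inv_rev, show σ * σ = 1 from hσ, inv_one] }
  have hV : commutator (alternatingGroup (Fin 4)) ≤ V := by
    rw [commutator_def, Subgroup.commutator_le]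
    have h : ∀ σ τ : alternatingGroup (Fin 4), ⁅σ, τ⁆ * ⁅σ, τ⁆ = 1 := by decide +kernel
    exact fun σ _ τ _ => h σ τ
  intro h
  have h1 : threeCycle * threeCycle = 1 := hV h
  exact absurd h1 (by decide)

end AltFive

end RootedTree

/-! ### Assembly of the theorem. -/

theorem mainTheorem7 :
    ∃ D T : Subgroup (TreeAut (alternatingGroup (Fin 5))),
      -- `G`, generated by the rooted group `Alt(5)` and by `D`, is a constant spinal group,
      -- and `D` is isomorphic to `Alt(4)`
      IsDirectedGroup D ∧ Nonempty (D ≃* alternatingGroup (Fin 4)) ∧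
      -- the subgroup `T` of `D` defines a special subgroup, and is cyclic of order 3
      T ≤ D ∧ IsDirectedGroup T ∧ IsCyclic T ∧ Nat.card T = 3 ∧
      IsLayered (spinalGroup D) ∧
      IsBranch (spinalGroup D) ∧
      ¬ IsMF (spinalGroup D) ∧
      ¬ HasCSP (spinalGroup D) ∧
      IsProdense ((spinalGroup T).subgroupOf (spinalGroup D)) ∧
      IsCoatom ((spinalGroup T).subgroupOf (spinalGroup D)) ∧
      ¬ ((spinalGroup T).subgroupOf (spinalGroup D)).FiniteIndex := by
  set δ := directed.comp altFourSections with hδ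
  have hinj : Function.Injective δ := directed_altFourSections_injective
  set B := Subgroup.zpowers threeCycle with hB
  have htB : threeCycle ∈ B := Subgroup.mem_zpowers _
  have htA : threeCycle ∈ (⊤ : Subgroup (alternatingGroup (Fin 4))) := Subgroup.mem_top _
  set D := (⊤ : Subgroup (alternatingGroup (Fin 4))).map δ with hDdef
  set T := B.map δ with hTdef
  have hD : IsDirectedGroup D := isDirectedGroup_altFour htA
  have hT : IsDirectedGroup T := isDirectedGroup_altFour htB
  have hG : VertClosed (spinalGroup D) := vertClosed_altFour htA
  have hH : VertClosed (spinalGroup T) := vertClosed_altFour htB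
  have hcard : Nat.card B = 3 := by rw [hB, Nat.card_zpowers, orderOf_threeCycle]
  have eT : B ≃* T := B.equivMapOfInjective δ hinj
  have eD : D ≃* alternatingGroup (Fin 4) :=
    ((⊤ : Subgroup (alternatingGroup (Fin 4))).equivMapOfInjective δ hinj).symm.trans
      Subgroup.topEquiv
  have hlt : B < ⊤ := by
    refine lt_top_iff_ne_top.2 fun h => ?_
    rw [h, Subgroup.card_top, nat_card_alternatingGroup, Nat.card_eq_fintype_card,
      Fintype.card_fin] at hcard
    exact absurd hcard (by decide)
  have hTD : T < D := (Subgroup.map_lt_map_iff_of_injective hinj).2 hlt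
  -- Pulled back to `Alt(4)`, the claim is that `threeCycle` and a conjugate outside its cyclic
  -- group generate.
  have hmax : ∀ M : Subgroup (TreeAut (alternatingGroup (Fin 5))), T ≤ M → ∀ d ∈ D, d ∉ T →
      (∀ m ∈ M, d * m * d⁻¹ ∈ M) → D ≤ M := by
    rintro M hTM _ ⟨d, -, rfl⟩ hdT hn
    have ht : δ threeCycle ∈ M := hTM ⟨_, htB, rfl⟩
    have htop : M.comap δ = ⊤ := eq_top_of_threeCycle_mem (d := d) ht
      (fun hd => hdT ⟨d, hd, rfl⟩) (by
        rw [Subgroup.mem_comap, map_mul, map_mul, map_inv]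
        exact hn _ ht)
    rw [hDdef, Subgroup.map_le_iff_le_comap, htop]
  have hcoatom := hD.isCoatom hT hTD hH hmax
  have hcore := hD.eq_bot_of_normal hT hTD hG
  have := hG.infinite_spinalGroup
  have hindex := not_finiteIndex_of_core_eq_bot hcore
  have hcsp : ¬ HasCSP (spinalGroup D) := by
    refine hD.not_hasCSP (Abelianization.of.comp eD.toMonoidHom) hG ⟨eD.symm threeCycle, ?_⟩
    intro h
    apply threeCycle_notMem_commutator
    rw [← Abelianization.ker_of, MonoidHom.mem_ker]
    simpa using h
  exact ⟨D, T, hD, ⟨eD⟩, hTD.le, hT, isCyclic_of_surjective eT eT.surjective,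
    by rw [← Nat.card_congr eT.toEquiv, hcard],
    hG.isLayered hD.isSelfSimilar spinalGroup_transitive_one,
    hG.isBranch hD.isSelfSimilar spinalGroup_transitive_one,
    fun h => hindex (h _ hcoatom), hcsp, isProdense_of_isCoatom hcoatom hcore, hcoatom, hindex⟩
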